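/- **Setting.** Let $\Sigma$ be a finite alphabet, $M$ a finite monoid, $h:\Sigma^*\to M$ a monoid homomorphism and $f\ge 1$. For a tuple of words put $h^{(d)}(w_1,\dots,w_d)=(h(w_1),\dots,h(w_d))$. *Contexts.* A sentence context of arity $d$ is $E=u_0\square_{\sigma(1)}u_1\cdots\square_{\sigma(d)}u_d$ with $\sigma\in S_d$ and $u_i\in\Sigma^*$; $E[\vec w]$ is the result of replacing each $\square_i$ by $w_i$. Its interface type is $\tau_h(E)=(\sigma;h(u_0),\dots,h(u_d))\in\mathcal I_h(d)=S_d\times M^{d+1}$; put $\tau_{\mathrm{st}}=\tau_h(\square_1)=(\mathrm{id};1,1)$. For $L\subseteq\Sigma^*$ let $\mathcal D_L(\vec x)=\{E: E[\vec x]\in L\}$. $L$ is $(f,h)$-tuple-substitutable if for all $1\le d\le f$ and $\vec x,\vec y\in(\Sigma^*)^d$: $h^{(d)}(\vec x)=h^{(d)}(\vec y)$ and $\mathcal D_L(\vec x)\cap\mathcal D_L(\vec y)\ne\emptyset$ imply $\mathcal D_L(\vec x)=\mathcal D_L(\vec y)$. *Grammars.* A working binary linear nondeleting MCFG $G$ has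 a finite set of nonterminals $A$ with fan-outs $\mu(A)\ge1$, a start symbol $S$ with $\mu(S)=1$, and finitely many rules: start rules $S\to A$ ($A\ne S$, $\mu(A)=1$), terminal rules $A\to(a)$ ($A\neq S$, $\mu(A)=1$, $a\in\Sigma$), and binary rules $A\to\rho(B,C)$ with $A,B,C\ne S$, where $\rho=(\alpha_1,\dots,\alpha_{\mu(A)})$ is a tuple of words over $\Sigma\cup\{x^1,\dots,x^{\mu(B)},y^1,\dots,y^{\mu(C)}\}$ containing every variable exactly once in total; $\rho(\vec u,\vec v)$ denotes simultaneous substitution of $\vec u$ for $x$ and $\vec v$ for $y$. $L_A(G)$ is the set of tuples derivable from $A$, and $L(G)=L_S(G)$. $G$ is reduced if every nonterminal is reachable from $S$ and productive; it has fan-out at most $f$ if $\mu(A)\le f$ for all $A$. *Typed refinement.* Let $\mathrm{out}_\rho(\mathbf q,\mathbf r)$ be the tuple obtained from $\rho$ by replacing $a$ by $h(a)$, $x^i$ by $q_i$, $y^j$ by $r_j$ and multiplying in $M$. For $\tau=(\sigma;m_0,\dots,m_e)$, let $\mathrm{IT}^\rho_B(\tau,\mathbf r)=(\kappa;n_0,\dots,n_{d})$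 be read off from the formal word $m_0\,\alpha_{\sigma(1)}\,m_1\cdots\alpha_{\sigma(e)}\,m_e$ after replacing each terminal $a$ by $h(a)$ and each $y^j$ by $r_j$: $\kappa$ is the left-to-right order of the $x$-variables and the $n_i$ are the products in $M$ of the blocks between them; $\mathrm{IT}^\rho_C(\tau,\mathbf q)$ is defined symmetrically. The full typed refinement of $G$ has a fresh start symbol $\widetilde S$, nonterminals $A^\tau_{\mathbf p}$ ($\mathbf p\in M^{\mu(A)}$, $\tau\in\mathcal I_h(\mu(A))$), and the rules $\widetilde S\to A^{\tau_{\mathrm{st}}}_{(p)}$ for each $S\to A$ in $G$ and $p\in M$; $A^\tau_{(h(a))}\to(a)$ for each $A\to(a)$ in $G$ and each $\tau$; and $A^\tau_{\mathrm{out}_\rho(\mathbf q,\mathbf r)}\to\rho\bigl(B^{\mathrm{IT}_B^\rho(\tau,\mathbf r)}_{\mathbf q},C^{\mathrm{IT}_C^\rho(\tau,\mathbf q)}_{\mathbf r}\bigr)$ for each $A\to\rho(B,C)$ in $G$ and all $\mathbf q,\mathbf r,\tau$. The trimmed typed refinement $\widetilde G$ keeps $\widetilde S$ and exactly those typed nonterminals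 and rules that occur in some derivation tree rooted at $\widetilde S$. *Characteristic sample.* Fix a well-order on $(\Sigma^*)^d$ and a well-order on the contexts of arity $d$, for each $d$, the latter comparing the total length $\sum|u_i|$ first. With $L=L(G)$, for a typed nonterminal $X=A^\tau_{\mathbf p}$ of $\widetilde G$ let $\omega(X)$ be the least tuple of $L_X(\widetilde G)$ and $\chi(X)$ the least context $E$ with $\tau_h(E)=\tau$ and $E[\omega(X)]\in L$. Then $\mathrm{CS}(\widetilde G)$ consists of the words $\chi(X)[\omega(X)]$ for all typed nonterminals $X$ of $\widetilde G$, $\chi(X)[(a)]$ for all rules $X\to(a)$ of $\widetilde G$, and $\chi(X)[\rho(\omega(Y),\omega(Z))]$ for all rules $X\to\rho(Y,Z)$ of $\widetilde G$. *Learner.* For a finite $K\subseteq\Sigma^*$, a pair $[\vec x:\tau]$ of arity $d$, $1\le d\le f$, is observed if some context $E$ of arity $d$ has $E[\vec x]\in K$ and $\tau_h(E)=\tau$. The grammar $\hat G(K)$ has a fresh start symbol $\widehat S$, the observed pairs as further nonterminals, and the rules: (i) $\widehat S\to[(w):\tau_{\mathrm{st}}]$ for $w\in K$; (ii) $[(a):\tau]\to(a)$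 for observed $[(a):\tau]$, $a\in\Sigma$; (iii) $[\vec z:\tau_h(E)]\to\rho([\vec x:\tau_B],[\vec y:\tau_C])$ whenever $E$ is a context of arity $e$ with $1\le e\le f$, $E[\vec z]\in K$, $[\vec x:\tau_B]$ and $[\vec y:\tau_C]$ are observed, $\rho$ is a tuple of template words using every variable exactly once with $\rho(\vec x,\vec y)=\vec z$, $\tau_B=\mathrm{IT}^\rho_B(\tau_h(E),h(\vec y))$ and $\tau_C=\mathrm{IT}^\rho_C(\tau_h(E),h(\vec x))$, with $h$ applied componentwise; (iv) unit rules $[\vec x:\tau]\to[\vec y:\tau]$ for observed pairs of the same arity $d$ with $h^{(d)}(\vec x)=h^{(d)}(\vec y)$ for which some context $E$ with $\tau_h(E)=\tau$ has $E[\vec x]\in K$ and $E[\vec y]\in K$. **Theorem.** Let $G$ be a reduced working binary linear nondeleting MCFG over $\Sigma$ of fan-out at most $f$ such that $L=L(G)$ is $(f,h)$-tuple-substitutable, and let $\widetilde G$ be its trimmed typed refinement. Then $\mathrm{CS}(\widetilde G)$ is finite, $\mathrm{CS}(\widetilde G)\subseteq L$, and for every finite $K$ with $\mathrm{CS}(\widetilde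 G)\subseteq K\subseteq L$ one has $L(\hat G(K))=L$. -/

import Mathlib

/-!  Words over an alphabet `T` are lists.  A nonterminal alphabet with a fan-out map is given as a
ranked family `N : ℕ → Type`, where `N d` holds the nonterminals of fan-out `d`; a tuple of `d`
words is a function `Fin d → List T`. -/

namespace TupleMCFG

universe u v w

/-- A tuple of `d` words. -/
abbrev Tuple (T : Type u) (d : ℕ) : Type u := Fin d → List T

/-! ### Words with named holes, sentence contexts, interface types -/

/-- The word `g₀ □_{σ(1)} g₁ ⋯ □_{σ(d)} g_d` over `α`, in which each of the `d` named holes occurs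
exactly once; `perm` sends a left-to-right position to the name of the hole at that position. -/
@[ext]
structure HoleWord (α : Type u) (d : ℕ) where
  perm : Equiv.Perm (Fin d)
  gap : Fin (d + 1) → List α

/-- A sentence context of arity `d` over the terminal alphabet `T`. -/
abbrev SentCtx (T : Type u) (d : ℕ) : Type u := HoleWord T d

/-- A sentence-interface type of arity `d`, an element of `S_d × M^{d+1}`. -/
@[ext]
structure Iface (M : Type v) (d : ℕ) where
  perm : Equiv.Perm (Fin d)
  val : Fin (d + 1) → M

/-- The interface type `(id₁; 1, 1)` of the empty unary context. -/
def Iface.st (M : Type v) [Monoid M] : Iface M 1 := ⟨1, fun _ => 1⟩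

/-- The names of the holes of a word over `α ∪ {□_k}`, read from left to right. -/
def holes {α : Type u} {β : Type v} (l : List (α ⊕ β)) : List β := l.filterMap Sum.getRight?

theorem holes_nil {α : Type u} {β : Type v} : holes ([] : List (α ⊕ β)) = [] := rfl

theorem holes_inl {α : Type u} {β : Type v} (a : α) (l : List (α ⊕ β)) :
    holes (Sum.inl a :: l) = holes l := rfl

theorem holes_inr {α : Type u} {β : Type v} (b : β) (l : List (α ⊕ β)) :
    holes (Sum.inr b :: l) = b :: holes l := rfl

theorem holes_append {α : Type u} {β : Type v} (l l' : List (α ⊕ β)) :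
    holes (l ++ l') = holes l ++ holes l' := List.filterMap_append

theorem holes_flatMap {α : Type u} {β : Type v} {γ : Type w} (l : List γ)
    (g : γ → List (α ⊕ β)) : holes (l.flatMap g) = l.flatMap fun c => holes (g c) :=
  List.filterMap_flatMap

/-- The word over `α ∪ {□₁, …, □_d}` that a `HoleWord` stands for. -/
def HoleWord.toWord {α : Type u} {d : ℕ} (E : HoleWord α d) : List (α ⊕ Fin d) :=
  (E.gap 0).map Sum.inl ++
    (List.finRange d).flatMap fun i => Sum.inr (E.perm i) :: (E.gap i.succ).map Sum.inl

/-- `E[w₁, …, w_d]`: every hole `□_i` is replaced by `w_i`. -/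
def HoleWord.fill {α : Type u} {d : ℕ} (E : HoleWord α d) (w : Fin d → List α) : List α :=
  E.gap 0 ++ (List.finRange d).flatMap fun i => w (E.perm i) ++ E.gap i.succ

/-- The number of terminal letters of a context. -/
def HoleWord.termLength {α : Type u} {d : ℕ} (E : HoleWord α d) : ℕ := ∑ i, (E.gap i).length

/-- The `h`-sentence-interface type `τ_h(E) = (σ; h(u₀), …, h(u_d))`. -/
def HoleWord.iface {T : Type u} {M : Type v} [Monoid M] (h : FreeMonoid T →* M) {d : ℕ}
    (E : SentCtx T d) : Iface M d :=
  ⟨E.perm, fun i => h (FreeMonoid.ofList (E.gap i))⟩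

/-- The componentwise `h`-type of a tuple. -/
def htype {T : Type u} {M : Type v} [Monoid M] (h : FreeMonoid T →* M) {d : ℕ}
    (x : Tuple T d) : Fin d → M :=
  fun i => h (FreeMonoid.ofList (x i))

/-- The arity-`d` tuple distribution of `x` in `L`. -/
def tupleDist {T : Type u} (L : Set (List T)) {d : ℕ} (x : Tuple T d) : Set (SentCtx T d) :=
  {E | E.fill x ∈ L}

/-- `(f,h)`-tuple substitutability of a language. -/
def TupleSubstitutable {T : Type u} {M : Type v} [Monoid M] (f : ℕ) (h : FreeMonoid T →* M)
    (L : Set (List T)) : Prop :=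
  ∀ d : ℕ, 1 ≤ d → d ≤ f → ∀ x y : Tuple T d, htype h x = htype h y →
    (tupleDist L x ∩ tupleDist L y).Nonempty → tupleDist L x = tupleDist L y

/-! ### Cutting a word at its holes -/

theorem exists_blocks {α : Type u} {β : Type v} (l : List (α ⊕ β)) :
    ∃ (g : List α) (bs : List (β × List α)),
      l = g.map Sum.inl ++ bs.flatMap (fun b => Sum.inr b.1 :: b.2.map Sum.inl) ∧
      bs.map Prod.fst = holes l := by
  induction l with
  | nil => exact ⟨[], [], by simp [holes]⟩
  | cons s l ih =>
    obtain ⟨g, bs, h1, h2⟩ := ih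
    cases s with
    | inl a => exact ⟨a :: g, bs, by simp [h1], by rw [holes_inl, h2]⟩
    | inr b => exact ⟨[], (b, g) :: bs, by simp [h1], by simp [h2, holes_inr]⟩

/-- A word in which every one of the holes `□₁, …, □_d` occurs exactly once is of the form
`g₀ □_{κ(1)} g₁ ⋯ □_{κ(d)} g_d`. -/
theorem exists_toWord_eq {α : Type u} {d : ℕ} (l : List (α ⊕ Fin d))
    (hl : ∀ k, (holes l).count k = 1) : ∃ E : HoleWord α d, E.toWord = l := by
  obtain ⟨g, bs, h1, h2⟩ := exists_blocks l
  have hnd : (holes l).Nodup := List.nodup_iff_count_le_one.2 fun k => (hl k).le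
  have hperm : (holes l).Perm (List.finRange d) := by
    rw [List.perm_iff_count]
    intro k
    rw [hl k, List.count_eq_one_of_mem (List.nodup_finRange d) (List.mem_finRange k)]
  have hlen : bs.length = d := by
    have := hperm.length_eq
    rw [← h2] at this
    simpa using this
  clear hperm
  obtain ⟨F, hF⟩ : ∃ F : Fin d → Fin d × List α, bs = (List.finRange d).map F := by
    refine ⟨fun i => bs.get (i.cast hlen.symm), ?_⟩
    apply List.ext_get <;> simp [hlen]
  have hinj : Function.Injective fun i => (F i).1 := by
    rw [← h2, hF, List.map_map] at hnd
    intro i j hij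
    exact List.inj_on_of_nodup_map hnd (List.mem_finRange i) (List.mem_finRange j) hij
  refine ⟨⟨Equiv.ofBijective _ (Finite.injective_iff_bijective.1 hinj),
    Fin.cases g fun i => (F i).2⟩, ?_⟩
  rw [h1, hF, List.flatMap_map]
  simp only [HoleWord.toWord, Fin.cases_zero, Fin.cases_succ, Equiv.ofBijective_apply]

/-- The decomposition of a word at its holes, each hole occurring exactly once. -/
noncomputable def cut {α : Type u} {d : ℕ} (l : List (α ⊕ Fin d))
    (hl : ∀ k, (holes l).count k = 1) : HoleWord α d :=
  (exists_toWord_eq l hl).choose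

/-! ### Binary templates, output maps and interface transport -/

/-- The template `(α₁, …, α_e)` of a binary linear nondeleting rule: words over the terminals, the
variables `x¹, …, x^b` (`Sum.inr (Sum.inl i)`) and `y¹, …, y^c` (`Sum.inr (Sum.inr j)`), every
variable occurring exactly once in the whole tuple. -/
structure Template (T : Type u) (e b c : ℕ) where
  comp : Fin e → List (T ⊕ (Fin b ⊕ Fin c))
  linear : ∀ k, ∑ i, (holes (comp i)).countP (· = k) = 1

namespace Template

variable {T : Type u} {M : Type v} {e b c : ℕ}

/-- `ρ(u, v)`, simultaneous substitution of `u` for `x` and `v` for `y`. -/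
def apply (ρ : Template T e b c) (x : Tuple T b) (y : Tuple T c) : Tuple T e :=
  fun i => (ρ.comp i).flatMap (Sum.elim (fun a => [a]) (Sum.elim x y))

/-- The rule-output map `out_ρ(q, r)`. -/
def out [Monoid M] (h : FreeMonoid T →* M) (ρ : Template T e b c) (q : Fin b → M) (r : Fin c → M) :
    Fin e → M :=
  fun i => ((ρ.comp i).map (Sum.elim (fun a => h (FreeMonoid.of a)) (Sum.elim q r))).prod

/-- The word `m₀ β_{σ(1)} m₁ ⋯ β_{σ(e)} m_e` for an interface `(σ; m₀, …, m_e)`. -/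
def wrap {d : ℕ} (τ : Iface M e) (β : Fin e → List (M ⊕ Fin d)) : List (M ⊕ Fin d) :=
  Sum.inl (τ.val 0) ::
    (List.finRange e).flatMap fun i => β (τ.perm i) ++ [Sum.inl (τ.val i.succ)]

/-- The decorated `B`-trace: terminals `a` become `h a`, each `y^j` becomes `r_j`, and the
variables `x^k` stay visible. -/
def traceB [Monoid M] (h : FreeMonoid T →* M) (ρ : Template T e b c) (τ : Iface M e) (r : Fin c → M) :
    List (M ⊕ Fin b) :=
  wrap τ fun i => (ρ.comp i).map
    (Sum.elim (fun a => Sum.inl (h (FreeMonoid.of a))) (Sum.elim Sum.inr fun j => Sum.inl (r j)))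

/-- The decorated `C`-trace: terminals `a` become `h a`, each `x^k` becomes `q_k`, and the
variables `y^j` stay visible. -/
def traceC [Monoid M] (h : FreeMonoid T →* M) (ρ : Template T e b c) (τ : Iface M e) (q : Fin b → M) :
    List (M ⊕ Fin c) :=
  wrap τ fun i => (ρ.comp i).map
    (Sum.elim (fun a => Sum.inl (h (FreeMonoid.of a))) (Sum.elim (fun k => Sum.inl (q k)) Sum.inr))

theorem count_holes_wrap {d : ℕ} (τ : Iface M e) (β : Fin e → List (M ⊕ Fin d)) (k : Fin d) :
    (holes (wrap τ β)).count k = ∑ i, (holes (β i)).count k := by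
  have h1 : holes (wrap τ β) = (List.finRange e).flatMap fun i => holes (β (τ.perm i)) := by
    rw [wrap, holes_inl, holes_flatMap]
    simp only [holes_append, holes_inl, holes_nil, List.append_nil]
  rw [h1, List.count_flatMap, ← Equiv.sum_comp τ.perm, ← List.sum_ofFn, List.ofFn_eq_map]
  rfl

theorem linear_traceB [Monoid M] (h : FreeMonoid T →* M) (ρ : Template T e b c) (τ : Iface M e)
    (r : Fin c → M) (k : Fin b) : (holes (traceB h ρ τ r)).count k = 1 := by
  rw [traceB, count_holes_wrap, ← ρ.linear (Sum.inl k)]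
  refine Finset.sum_congr rfl fun i _ => ?_
  induction ρ.comp i with
  | nil => rfl
  | cons s l ih =>
    rcases s with a | x | y <;>
      simp_all [holes_inl, holes_inr, List.count_cons, List.countP_cons]

theorem linear_traceC [Monoid M] (h : FreeMonoid T →* M) (ρ : Template T e b c) (τ : Iface M e)
    (q : Fin b → M) (k : Fin c) : (holes (traceC h ρ τ q)).count k = 1 := by
  rw [traceC, count_holes_wrap, ← ρ.linear (Sum.inr k)]
  refine Finset.sum_congr rfl fun i _ => ?_
  induction ρ.comp i with
  | nil => rfl
  | cons s l ih =>
    rcases s with a | x | y <;>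
      simp_all [holes_inl, holes_inr, List.count_cons, List.countP_cons]

/-- The interface read off from a decomposed trace: every block is contracted to its product. -/
def blockIface [Monoid M] {d : ℕ} (E : HoleWord M d) : Iface M d := ⟨E.perm, fun i => (E.gap i).prod⟩

/-- Child interface transport `IT_B^ρ(τ, r)`. -/
noncomputable def itB [Monoid M] (h : FreeMonoid T →* M) (ρ : Template T e b c) (τ : Iface M e)
    (r : Fin c → M) : Iface M b :=
  blockIface (cut (traceB h ρ τ r) (linear_traceB h ρ τ r))

/-- Child interface transport `IT_C^ρ(τ, q)`. -/
noncomputable def itC [Monoid M] (h : FreeMonoid T →* M) (ρ : Template T e b c) (τ : Iface M e)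
    (q : Fin b → M) : Iface M c :=
  blockIface (cut (traceC h ρ τ q) (linear_traceC h ρ τ q))

end Template

/-! ### Grammars -/

/-- Rules over a ranked nonterminal alphabet: `S → A`, `A → (a)`, `A → ρ(B, C)`, and the unit rules
`A → B` of extended grammars. -/
inductive Rule (T : Type u) (N : ℕ → Type w) : Type (max u w)
  | start (A : N 1) : Rule T N
  | term (A : N 1) (a : T) : Rule T N
  | binary {e b c : ℕ} (A : N e) (ρ : Template T e b c) (B : N b) (C : N c) : Rule T N
  | unit {d : ℕ} (A B : N d) : Rule T N

/-- A grammar: start symbol, set of nonterminals (as a subset of the ambient ranked family), and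
set of rules. -/
structure Grammar (T : Type u) (N : ℕ → Type w) where
  S : N 1
  nt : Set (Σ d, N d)
  rules : Set (Rule T N)

namespace Grammar

variable {T : Type u} {N : ℕ → Type w}

/-- Working binary linear nondeleting MCFGs, start-separation included. -/
structure IsWorking (G : Grammar T N) : Prop where
  finite_nt : G.nt.Finite
  finite_rules : G.rules.Finite
  start_mem : ⟨1, G.S⟩ ∈ G.nt
  fanout_pos : ∀ X ∈ G.nt, 0 < X.1
  start_rule : ∀ A, Rule.start A ∈ G.rules → ⟨1, A⟩ ∈ G.nt ∧ A ≠ G.S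
  term_rule : ∀ A a, Rule.term A a ∈ G.rules → ⟨1, A⟩ ∈ G.nt ∧ A ≠ G.S
  binary_rule : ∀ (e b c : ℕ) (A : N e) (ρ : Template T e b c) (B : N b) (C : N c),
    Rule.binary A ρ B C ∈ G.rules →
      (⟨e, A⟩ ∈ G.nt ∧ ⟨b, B⟩ ∈ G.nt ∧ ⟨c, C⟩ ∈ G.nt) ∧
      ((⟨e, A⟩ : Σ d, N d) ≠ ⟨1, G.S⟩ ∧ (⟨b, B⟩ : Σ d, N d) ≠ ⟨1, G.S⟩ ∧
        (⟨c, C⟩ : Σ d, N d) ≠ ⟨1, G.S⟩)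
  no_unit : ∀ (d : ℕ) (A B : N d), Rule.unit A B ∉ G.rules

/-- Derivation trees of `G` with a given root label. -/
inductive Tree (G : Grammar T N) : {d : ℕ} → N d → Type (max u w)
  | start {R A : N 1} (hR : R = G.S) (hr : Rule.start A ∈ G.rules) (t : Tree G A) : Tree G R
  | term {A : N 1} {a : T} (hr : Rule.term A a ∈ G.rules) : Tree G A
  | binary {e b c : ℕ} {A : N e} {ρ : Template T e b c} {B : N b} {C : N c}
      (hr : Rule.binary A ρ B C ∈ G.rules) (t : Tree G B) (s : Tree G C) : Tree G A
  | unit {d : ℕ} {A B : N d} (hr : Rule.unit A B ∈ G.rules) (t : Tree G B) : Tree G A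

/-- The tuple derived by a derivation tree. -/
def Tree.yield {G : Grammar T N} : {d : ℕ} → {A : N d} → Tree G A → Tuple T d
  | _, _, .start _ _ t => t.yield
  | _, _, .term (a := a) _ => fun _ => [a]
  | _, _, .binary (ρ := ρ) _ t s => ρ.apply t.yield s.yield
  | _, _, .unit _ t => t.yield

/-- The nonterminals labelling the nodes of a derivation tree. -/
def Tree.labels {G : Grammar T N} : {d : ℕ} → {A : N d} → Tree G A → Set (Σ d, N d)
  | _, A, .start _ _ t => insert ⟨_, A⟩ t.labels
  | _, A, .term _ => {⟨_, A⟩}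
  | _, A, .binary _ t s => insert ⟨_, A⟩ (t.labels ∪ s.labels)
  | _, A, .unit _ t => insert ⟨_, A⟩ t.labels

/-- The rules used at the nodes of a derivation tree. -/
def Tree.rulesUsed {G : Grammar T N} : {d : ℕ} → {A : N d} → Tree G A → Set (Rule T N)
  | _, _, .start (A := A) _ _ t => insert (Rule.start A) t.rulesUsed
  | _, _, .term (A := A) (a := a) _ => {Rule.term A a}
  | _, _, .binary (A := A) (ρ := ρ) (B := B) (C := C) _ t s =>
      insert (Rule.binary A ρ B C) (t.rulesUsed ∪ s.rulesUsed)
  | _, _, .unit (A := A) (B := B) _ t => insert (Rule.unit A B) t.rulesUsed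

/-- The tuple language `L_A(G)`. -/
def tupleLang (G : Grammar T N) {d : ℕ} (A : N d) : Set (Tuple T d) :=
  Set.range fun t : Tree G A => t.yield

/-- The string language `L(G) = L_S(G)`. -/
def language (G : Grammar T N) : Set (List T) := {w | (fun _ => w) ∈ G.tupleLang G.S}

/-- Reachability of nonterminals from the start symbol. -/
inductive Reachable (G : Grammar T N) : {d : ℕ} → N d → Prop
  | root : Reachable G G.S
  | start {A : N 1} (hr : Rule.start A ∈ G.rules) : Reachable G A
  | left {e b c : ℕ} {A : N e} {ρ : Template T e b c} {B : N b} {C : N c}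
      (hr : Rule.binary A ρ B C ∈ G.rules) (hA : Reachable G A) : Reachable G B
  | right {e b c : ℕ} {A : N e} {ρ : Template T e b c} {B : N b} {C : N c}
      (hr : Rule.binary A ρ B C ∈ G.rules) (hA : Reachable G A) : Reachable G C
  | unit {d : ℕ} {A B : N d} (hr : Rule.unit A B ∈ G.rules) (hA : Reachable G A) : Reachable G B

/-- Every nonterminal is reachable and productive. -/
def IsReduced (G : Grammar T N) : Prop :=
  ∀ (d : ℕ) (A : N d), ⟨d, A⟩ ∈ G.nt → G.Reachable A ∧ (G.tupleLang A).Nonempty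

/-- The subgrammar of the nonterminals and rules that occur in successful derivation trees. -/
def trim (G : Grammar T N) : Grammar T N where
  S := G.S
  nt := insert ⟨1, G.S⟩ {X | ∃ t : Tree G G.S, X ∈ t.labels}
  rules := {r | ∃ t : Tree G G.S, r ∈ t.rulesUsed}

end Grammar

/-! ### Typed refinement -/

/-- A fresh start symbol and the typed copies `A_p^τ`. -/
inductive TypedNT (M : Type v) (N : ℕ → Type w) : ℕ → Type (max v w)
  | fresh : TypedNT M N 1
  | copy {d : ℕ} (A : N d) (p : Fin d → M) (τ : Iface M d) : TypedNT M N d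

section Refinement

variable {T : Type u} {M : Type v} [Monoid M] {N : ℕ → Type w}

/-- The rules of the full typed refinement. -/
inductive TypedRule (h : FreeMonoid T →* M) (G : Grammar T N) : Rule T (TypedNT M N) → Prop
  | start (A : N 1) (p : Fin 1 → M) (hr : Rule.start A ∈ G.rules) :
      TypedRule h G (Rule.start (TypedNT.copy A p (Iface.st M)))
  | term (A : N 1) (a : T) (τ : Iface M 1) (hr : Rule.term A a ∈ G.rules) :
      TypedRule h G (Rule.term (TypedNT.copy A (fun _ => h (FreeMonoid.of a)) τ) a)
  | binary {e b c : ℕ} (A : N e) (ρ : Template T e b c) (B : N b) (C : N c)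
      (q : Fin b → M) (r : Fin c → M) (τ : Iface M e) (hr : Rule.binary A ρ B C ∈ G.rules) :
      TypedRule h G (Rule.binary (TypedNT.copy A (ρ.out h q r) τ) ρ
        (TypedNT.copy B q (ρ.itB h τ r)) (TypedNT.copy C r (ρ.itC h τ q)))

/-- The full typed refinement of `G`. -/
def fullRefinement (h : FreeMonoid T →* M) (G : Grammar T N) : Grammar T (TypedNT M N) where
  S := TypedNT.fresh
  nt := insert ⟨1, TypedNT.fresh⟩
    {X | ∃ (d : ℕ) (A : N d) (p : Fin d → M) (τ : Iface M d),
      ⟨d, A⟩ ∈ G.nt ∧ X = ⟨d, TypedNT.copy A p τ⟩}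
  rules := {r | TypedRule h G r}

/-- The trimmed typed refinement of `G`. -/
def trimmedRefinement (h : FreeMonoid T →* M) (G : Grammar T N) : Grammar T (TypedNT M N) :=
  (fullRefinement h G).trim

end Refinement

/-! ### Anchors, exposing contexts and the characteristic sample -/

/-- A choice of total orders on tuples of words and on sentence contexts in which nonempty sets
have least elements, the order on contexts comparing terminal lengths first. -/
structure ExposureOrders (T : Type u) where
  tupleLT : ∀ d, Tuple T d → Tuple T d → Prop
  tuple_wo : ∀ d, IsWellOrder (Tuple T d) (tupleLT d)
  ctxLT : ∀ d, SentCtx T d → SentCtx T d → Prop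
  ctx_wo : ∀ d, IsWellOrder (SentCtx T d) (ctxLT d)
  ctx_length : ∀ d (E F : SentCtx T d), E.termLength < F.termLength → ctxLT d E F

/-- Such orders exist. -/
theorem nonempty_exposureOrders (T : Type u) : Nonempty (ExposureOrders T) := by
  refine ⟨⟨fun _ => WellOrderingRel, fun _ => inferInstance,
    fun d => InvImage (Prod.Lex (· < ·) WellOrderingRel)
      (fun E : SentCtx T d => (E.termLength, E)), fun d => ?_, fun d E F h => ?_⟩⟩
  · have inj : Function.Injective (fun E : SentCtx T d => (E.termLength, E)) :=
      fun _ _ h => congrArg Prod.snd h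
    exact (RelEmbedding.isWellOrder (⟨⟨_, inj⟩, Iff.rfl⟩ :
      InvImage (Prod.Lex (· < ·) WellOrderingRel)
        (fun E : SentCtx T d => (E.termLength, E)) ↪r
          Prod.Lex ((· < ·) : ℕ → ℕ → Prop) (WellOrderingRel (α := SentCtx T d))))
  · exact Prod.Lex.left _ _ h

/-- `a` is the least element of `s` with respect to the strict total order `r`. -/
def IsLeastFor {α : Type u} (r : α → α → Prop) (s : Set α) (a : α) : Prop :=
  a ∈ s ∧ ∀ b ∈ s, b ≠ a → r a b

section Sample

variable {T : Type u} {M : Type v} [Monoid M] {N : ℕ → Type w}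

/-- `a` is the anchor `ω(X)`, the least tuple of `L_X(H)`. -/
def IsAnchor (O : ExposureOrders T) (H : Grammar T (TypedNT M N)) {d : ℕ} (X : TypedNT M N d)
    (a : Tuple T d) : Prop :=
  IsLeastFor (O.tupleLT d) (H.tupleLang X) a

/-- `E` is the exposing context `χ(X)` of a typed nonterminal with interface `τ` and anchor `a`: the
least context of interface type `τ` that accepts `a` in `L`. -/
def IsExposing (O : ExposureOrders T) (h : FreeMonoid T →* M) (L : Set (List T)) {d : ℕ}
    (τ : Iface M d) (a : Tuple T d) (E : SentCtx T d) : Prop :=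
  IsLeastFor (O.ctxLT d) {F | F.iface h = τ ∧ F.fill a ∈ L} E

/-- Membership in the characteristic sample: the symbol observations `χ(X)[ω(X)]` of the typed
nonterminals, and the rule observations `χ(X)[(a)]` and `χ(X)[ρ(ω(Y), ω(Z))]` of the rules
`X → (a)` and `X → ρ(Y, Z)`. -/
inductive CharObs (O : ExposureOrders T) (h : FreeMonoid T →* M) (L : Set (List T))
    (H : Grammar T (TypedNT M N)) : List T → Prop
  | symbol {d : ℕ} {A : N d} {p : Fin d → M} {τ : Iface M d} {ω : Tuple T d} {χ : SentCtx T d}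
      (hX : ⟨d, TypedNT.copy A p τ⟩ ∈ H.nt) (hω : IsAnchor O H (TypedNT.copy A p τ) ω)
      (hχ : IsExposing O h L τ ω χ) : CharObs O h L H (χ.fill ω)
  | term {A : N 1} {p : Fin 1 → M} {τ : Iface M 1} {a : T} {ω : Tuple T 1} {χ : SentCtx T 1}
      (hR : Rule.term (TypedNT.copy A p τ) a ∈ H.rules)
      (hω : IsAnchor O H (TypedNT.copy A p τ) ω) (hχ : IsExposing O h L τ ω χ) :
      CharObs O h L H (χ.fill fun _ => [a])
  | binary {e b c : ℕ} {A : N e} {p : Fin e → M} {τ : Iface M e} {ρ : Template T e b c}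
      {Y : TypedNT M N b} {Z : TypedNT M N c}
      {ω : Tuple T e} {ωY : Tuple T b} {ωZ : Tuple T c} {χ : SentCtx T e}
      (hR : Rule.binary (TypedNT.copy A p τ) ρ Y Z ∈ H.rules)
      (hω : IsAnchor O H (TypedNT.copy A p τ) ω) (hχ : IsExposing O h L τ ω χ)
      (hY : IsAnchor O H Y ωY) (hZ : IsAnchor O H Z ωZ) :
      CharObs O h L H (χ.fill (ρ.apply ωY ωZ))

/-- The characteristic sample of the typed grammar `H` for the language `L`. -/
def charSample (O : ExposureOrders T) (h : FreeMonoid T →* M) (L : Set (List T))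
    (H : Grammar T (TypedNT M N)) : Set (List T) :=
  {w | CharObs O h L H w}

end Sample

/-! ### The canonical learner -/

/-- A fresh start symbol and the typed tuples `[x : τ]`. -/
inductive LearnerNT (T : Type u) (M : Type v) : ℕ → Type (max u v)
  | fresh : LearnerNT T M 1
  | tup {d : ℕ} (x : Tuple T d) (τ : Iface M d) : LearnerNT T M d

section Learner

variable {T : Type u} {M : Type v} [Monoid M]

/-- The typed tuple `[x : τ]` is observed in `K`. -/
def Observed (f : ℕ) (h : FreeMonoid T →* M) (K : Finset (List T)) {d : ℕ} (x : Tuple T d)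
    (τ : Iface M d) : Prop :=
  1 ≤ d ∧ d ≤ f ∧ ∃ E : SentCtx T d, E.fill x ∈ K ∧ E.iface h = τ

/-- A binary witness in `K` that is typed: a parent occurrence `(E, z)`, observed children
`[x : τ_B]` and `[y : τ_C]`, and a segmentation of the components of `z` into terminal letters and
variable intervals.  Such a segmentation, the relative order of empty intervals included, is the
same thing as a linear nondeleting template `ρ` with `ρ(x, y) = z`. -/
structure TypedWitness (f : ℕ) (h : FreeMonoid T →* M) (K : Finset (List T)) {e b c : ℕ}
    (E : SentCtx T e) (z : Tuple T e) (ρ : Template T e b c) (x : Tuple T b) (τB : Iface M b)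
    (y : Tuple T c) (τC : Iface M c) : Prop where
  parent_pos : 1 ≤ e
  parent_le : e ≤ f
  parent : E.fill z ∈ K
  left : Observed f h K x τB
  right : Observed f h K y τC
  segmentation : ρ.apply x y = z
  typed_left : ρ.itB h (E.iface h) (htype h y) = τB
  typed_right : ρ.itC h (E.iface h) (htype h x) = τC

/-- The rules of the learner grammar. -/
inductive LearnerRule (f : ℕ) (h : FreeMonoid T →* M) (K : Finset (List T)) :
    Rule T (LearnerNT T M) → Prop
  | start (w : List T) (hw : w ∈ K) (hobs : Observed f h K (fun _ : Fin 1 => w) (Iface.st M)) :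
      LearnerRule f h K (Rule.start (LearnerNT.tup (fun _ => w) (Iface.st M)))
  | term (a : T) (τ : Iface M 1) (hobs : Observed f h K (fun _ : Fin 1 => [a]) τ) :
      LearnerRule f h K (Rule.term (LearnerNT.tup (fun _ => [a]) τ) a)
  | binary {e b c : ℕ} (E : SentCtx T e) (z : Tuple T e) (ρ : Template T e b c)
      (x : Tuple T b) (τB : Iface M b) (y : Tuple T c) (τC : Iface M c)
      (hwit : TypedWitness f h K E z ρ x τB y τC) :
      LearnerRule f h K
        (Rule.binary (LearnerNT.tup z (E.iface h)) ρ (LearnerNT.tup x τB) (LearnerNT.tup y τC))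
  | subst {d : ℕ} (x y : Tuple T d) (τ : Iface M d) (hx : Observed f h K x τ)
      (hy : Observed f h K y τ) (hxy : htype h x = htype h y) (E : SentCtx T d)
      (hE : E.iface h = τ) (hEx : E.fill x ∈ K) (hEy : E.fill y ∈ K) :
      LearnerRule f h K (Rule.unit (LearnerNT.tup x τ) (LearnerNT.tup y τ))

/-- The canonical learner grammar `Ĝ(K)`. -/
def learnerGrammar (f : ℕ) (h : FreeMonoid T →* M) (K : Finset (List T)) :
    Grammar T (LearnerNT T M) where
  S := LearnerNT.fresh
  nt := insert ⟨1, LearnerNT.fresh⟩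
    {X | ∃ (d : ℕ) (x : Tuple T d) (τ : Iface M d),
      Observed f h K x τ ∧ X = ⟨d, LearnerNT.tup x τ⟩}
  rules := {r | LearnerRule f h K r}

end Learner

end TupleMCFG

/-!
The refinement `A_p^τ` records the `h`-type `p` of the derived tuple and the interface `τ` of the
surrounding sentence context. The types are sound because, for a context `E` and a template `ρ`,
both `E[ρ(□, y)]` and `E[ρ(x, □)]` are contexts whose interfaces are the transported ones
(`Template.exists_leftCtx`, `Template.exists_rightCtx`), and because `h` commutes with templates
(`Template.htype_apply`). Hence `G` and its typed refinement derive the same language, and every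
nonterminal `A_p^τ` occurring in a successful derivation has one context `E` of interface `τ` with
`E[w] ∈ L` for all tuples `w` derived from it (`IsPlaced`). All these tuples have type `p`, so by
substitutability they have the same distribution (`IsPlaced.tupleDist_eq`); in particular the
exposing context of `A_p^τ` accepts all of them, which puts the characteristic sample inside `L`.
The sample is finite because there are finitely many types, and each typed nonterminal or rule
contributes at most one word.

Every derivation of the learner from `[x : τ]` yields a tuple with the distribution of `x`
(`Grammar.Tree.tupleDist_yield`): binary rules preserve this since distributions are congruent for
templates, and unit rules by substitutability. So the learner derives only words of `L`. Conversely
the learner simulates the typed refinement, `[ω : τ]` playing the part of a nonterminal `A_p^τ` with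
anchor `ω` (`Grammar.Tree.yield_mem_learner`): a rule `A_p^τ → ρ(Y, Z)` becomes the unit rule from
`[ω : τ]` to `[ρ(ω_Y, ω_Z) : τ]`, supported by the symbol and rule observations in the same
exposing context, followed by the binary rule with children `[ω_Y : τ_Y]` and `[ω_Z : τ_Z]`.
At the root the exposing context is the empty one, since contexts are compared by length first,
so the anchor itself is a word of the sample.
-/

namespace TupleMCFG

universe u v w

/-! ### Substituting into contexts -/

section Words

variable {α : Type u} {T : Type u} {M : Type v} {β : Type w} {d e b c : ℕ}

/-- Every hole `□_k` of a word over `α ∪ {□_k}` is replaced by `x k`. -/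
def substHoles (x : β → List α) (l : List (α ⊕ β)) : List α :=
  l.flatMap (Sum.elim (fun a => [a]) x)

theorem substHoles_append (x : β → List α) (l l' : List (α ⊕ β)) :
    substHoles x (l ++ l') = substHoles x l ++ substHoles x l' := List.flatMap_append

theorem substHoles_flatMap {γ : Type*} (x : β → List α) (l : List γ) (g : γ → List (α ⊕ β)) :
    substHoles x (l.flatMap g) = l.flatMap fun i => substHoles x (g i) := List.flatMap_assoc

theorem substHoles_map_inl (x : β → List α) (l : List α) :
    substHoles x (l.map Sum.inl) = l := by
  simp [substHoles, List.flatMap_map]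

theorem substHoles_inr (x : β → List α) (k : β) (l : List (α ⊕ β)) :
    substHoles x (Sum.inr k :: l) = x k ++ substHoles x l := rfl

theorem HoleWord.substHoles_toWord (E : HoleWord α d) (x : Fin d → List α) :
    substHoles x E.toWord = E.fill x := by
  simp only [HoleWord.toWord, HoleWord.fill, substHoles_append, substHoles_flatMap,
    substHoles_inr, substHoles_map_inl]

theorem holes_map_inl (l : List α) : holes (l.map (Sum.inl : α → α ⊕ β)) = [] := by
  induction l with
  | nil => rfl
  | cons a l ih => rw [List.map_cons, holes_inl, ih]

/-- The word with holes that arises from a context `E` when each `□_i` is replaced by the word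
with holes `W i`. -/
def HoleWord.plug (E : HoleWord α e) (W : Fin e → List (α ⊕ β)) : List (α ⊕ β) :=
  (E.gap 0).map Sum.inl ++
    (List.finRange e).flatMap fun i => W (E.perm i) ++ (E.gap i.succ).map Sum.inl

theorem HoleWord.substHoles_plug (E : HoleWord α e) (W : Fin e → List (α ⊕ β))
    (x : β → List α) : substHoles x (E.plug W) = E.fill fun i => substHoles x (W i) := by
  simp only [HoleWord.plug, HoleWord.fill, substHoles_append, substHoles_flatMap,
    substHoles_map_inl]

theorem HoleWord.count_holes_plug (E : HoleWord α e) (W : Fin e → List (α ⊕ Fin d))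
    (k : Fin d) : (holes (E.plug W)).count k = ∑ i, (holes (W i)).count k := by
  have h1 : holes (E.plug W) = (List.finRange e).flatMap fun i => holes (W (E.perm i)) := by
    simp only [HoleWord.plug, holes_append, holes_flatMap, holes_map_inl, List.append_nil,
      List.nil_append]
  rw [h1, List.count_flatMap, ← Equiv.sum_comp E.perm, ← List.sum_ofFn, List.ofFn_eq_map]
  rfl

/-! ### Contracting the blocks of a word over a monoid -/

variable [Monoid M]

/-- A word over `M ∪ {□_k}` acting on a contracted word `m □_{k₁} m₁ □_{k₂} m₂ ⋯`, which is encoded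
as `(m, [(k₁, m₁), (k₂, m₂), …])`, by multiplication from the left: adjacent elements of `M` are
multiplied together. -/
def contract (l : List (M ⊕ β)) (s : M × List (β × M)) : M × List (β × M) :=
  l.foldr (fun z s => Sum.elim (fun m => (m * s.1, s.2)) (fun k => (1, (k, s.1) :: s.2)) z) s

theorem contract_append (l l' : List (M ⊕ β)) (s : M × List (β × M)) :
    contract (l ++ l') s = contract l (contract l' s) := List.foldr_append

theorem contract_inl (m : M) (l : List (M ⊕ β)) (s : M × List (β × M)) :
    contract (Sum.inl m :: l) s = (m * (contract l s).1, (contract l s).2) := rfl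

theorem contract_inr (k : β) (l : List (M ⊕ β)) (s : M × List (β × M)) :
    contract (Sum.inr k :: l) s = (1, (k, (contract l s).1) :: (contract l s).2) := rfl

theorem contract_map_inl (l : List M) (s : M × List (β × M)) :
    contract (l.map Sum.inl) s = (l.prod * s.1, s.2) := by
  induction l with
  | nil => simp [contract]
  | cons a l ih => rw [List.map_cons, contract_inl, ih, List.prod_cons, mul_assoc]

theorem contract_flatMap_congr {γ : Type*} (l : List γ) (g g' : γ → List (M ⊕ β))
    (hg : ∀ i s, contract (g i) s = contract (g' i) s) (s : M × List (β × M)) :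
    contract (l.flatMap g) s = contract (l.flatMap g') s := by
  induction l with
  | nil => rfl
  | cons a l ih => rw [List.flatMap_cons, List.flatMap_cons, contract_append, contract_append,
      ih, hg]

theorem contract_toWord (E : HoleWord M d) :
    contract E.toWord (1, []) = ((E.gap 0).prod,
      (List.finRange d).map fun i => (E.perm i, (E.gap i.succ).prod)) := by
  have key : ∀ l : List (Fin d),
      contract (l.flatMap fun i => Sum.inr (E.perm i) :: (E.gap i.succ).map Sum.inl) (1, []) =
        (1, l.map fun i => (E.perm i, (E.gap i.succ).prod)) := by
    intro l
    induction l with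
    | nil => rfl
    | cons a l ih =>
      rw [List.flatMap_cons, contract_append, ih, contract_inr, contract_map_inl]
      simp
  rw [HoleWord.toWord, contract_append, key, contract_map_inl, mul_one]

/-- The interface of a word with holes depends only on its contracted form. -/
theorem Template.blockIface_eq_of_contract_eq (E F : HoleWord M d)
    (h : contract E.toWord (1, []) = contract F.toWord (1, [])) :
    Template.blockIface E = Template.blockIface F := by
  rw [contract_toWord, contract_toWord, Prod.mk.injEq] at h
  have h2 := fun i => List.map_inj_left.1 h.2 i (List.mem_finRange i)
  simp only [Prod.mk.injEq] at h2
  refine Iface.ext (Equiv.ext fun i => (h2 i).1) (funext fun i => ?_)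
  refine Fin.cases h.1 (fun i => (h2 i).2) i

theorem toWord_cut (l : List (α ⊕ Fin d)) (hl : ∀ k, (holes l).count k = 1) :
    (cut l hl).toWord = l := (exists_toWord_eq l hl).choose_spec

variable (h : FreeMonoid T →* M)

theorem hom_ofList (l : List T) :
    h (FreeMonoid.ofList l) = (l.map fun a => h (FreeMonoid.of a)).prod := by
  induction l with
  | nil => simp
  | cons a l ih => rw [FreeMonoid.ofList_cons, map_mul, ih, List.map_cons, List.prod_cons]

/-- The letters of a word with holes replaced by their values in `M`. -/
def decorate (l : List (T ⊕ β)) : List (M ⊕ β) :=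
  l.map (Sum.map (fun a => h (FreeMonoid.of a)) id)

theorem decorate_inr (k : β) (l : List (T ⊕ β)) :
    decorate h (Sum.inr k :: l) = Sum.inr k :: decorate h l := rfl

theorem decorate_append (l l' : List (T ⊕ β)) :
    decorate h (l ++ l') = decorate h l ++ decorate h l' := List.map_append

theorem decorate_flatMap {γ : Type*} (l : List γ) (g : γ → List (T ⊕ β)) :
    decorate h (l.flatMap g) = l.flatMap fun i => decorate h (g i) := List.map_flatMap

theorem decorate_map_inl (l : List T) :
    decorate h (l.map (Sum.inl : T → T ⊕ β)) =
      (l.map fun a => h (FreeMonoid.of a)).map Sum.inl := by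
  simp [decorate]

theorem contract_decorate_map_inl (l : List T) (s : M × List (β × M)) :
    contract (decorate h (l.map Sum.inl)) s = (h (FreeMonoid.ofList l) * s.1, s.2) := by
  rw [decorate_map_inl, contract_map_inl, hom_ofList]

/-- Substituting words with holes for the holes of a context `E` gives a context again, and its
interface is computed from that of `E` and from the values of the substituted words. -/
theorem HoleWord.exists_plug (E : SentCtx T e) (W : Fin e → List (T ⊕ Fin d))
    (hW : ∀ k, ∑ i, (holes (W i)).count k = 1) (V : Fin e → List (M ⊕ Fin d))
    (hV : ∀ i s, contract (V i) s = contract (decorate h (W i)) s)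
    (hl : ∀ k, (holes (Template.wrap (E.iface h) V)).count k = 1) :
    ∃ F : SentCtx T d, (∀ x, F.fill x = E.fill fun i => substHoles x (W i)) ∧
      F.iface h = Template.blockIface (cut (Template.wrap (E.iface h) V) hl) := by
  have hc : ∀ k, (holes (E.plug W)).count k = 1 := fun k => by rw [E.count_holes_plug, hW]
  refine ⟨cut _ hc, fun x => ?_, ?_⟩
  · rw [← HoleWord.substHoles_toWord, toWord_cut, E.substHoles_plug]
  · set F := cut _ hc with hF
    have h1 : F.iface h =
        Template.blockIface ⟨F.perm, fun i => (F.gap i).map fun a => h (FreeMonoid.of a)⟩ :=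
      Iface.ext rfl (funext fun i => hom_ofList h _)
    have h2 : HoleWord.toWord ⟨F.perm, fun i => (F.gap i).map fun a => h (FreeMonoid.of a)⟩ =
        decorate h F.toWord := by
      simp only [HoleWord.toWord, decorate_append, decorate_flatMap, decorate_inr,
        decorate_map_inl]
    rw [h1]
    refine Template.blockIface_eq_of_contract_eq _ _ ?_
    rw [h2, hF, toWord_cut, toWord_cut, HoleWord.plug, decorate_append, contract_append,
      contract_decorate_map_inl, decorate_flatMap, Template.wrap, contract_inl]
    have h3 := contract_flatMap_congr (List.finRange e)
      (fun i => decorate h (W (E.perm i) ++ (E.gap i.succ).map Sum.inl))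
      (fun i => V ((E.iface h).perm i) ++ [Sum.inl ((E.iface h).val i.succ)])
      (fun i s => by
        rw [decorate_append, contract_append, contract_decorate_map_inl, contract_append, hV]
        rfl) (1, [])
    rw [h3]
    rfl

namespace Template

variable (ρ : Template T e b c)

/-- The components of `ρ(x, y)` in which the variables `x` are left as holes. -/
def leftHoles (y : Tuple T c) (i : Fin e) : List (T ⊕ Fin b) :=
  (ρ.comp i).flatMap
    (Sum.elim (fun a => [Sum.inl a]) (Sum.elim (fun k => [Sum.inr k]) fun j => (y j).map Sum.inl))

/-- The components of `ρ(x, y)` in which the variables `y` are left as holes. -/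
def rightHoles (x : Tuple T b) (i : Fin e) : List (T ⊕ Fin c) :=
  (ρ.comp i).flatMap
    (Sum.elim (fun a => [Sum.inl a]) (Sum.elim (fun k => (x k).map Sum.inl) fun j => [Sum.inr j]))

theorem substHoles_leftHoles (x : Tuple T b) (y : Tuple T c) :
    (fun i => substHoles x (ρ.leftHoles y i)) = ρ.apply x y := by
  funext i
  rw [leftHoles, substHoles_flatMap, apply]
  refine List.flatMap_congr fun z _ => ?_
  rcases z with a | k | j
  · rfl
  · simp [substHoles]
  · exact substHoles_map_inl _ _

theorem substHoles_rightHoles (x : Tuple T b) (y : Tuple T c) :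
    (fun i => substHoles y (ρ.rightHoles x i)) = ρ.apply x y := by
  funext i
  rw [rightHoles, substHoles_flatMap, apply]
  refine List.flatMap_congr fun z _ => ?_
  rcases z with a | k | j
  · rfl
  · exact substHoles_map_inl _ _
  · simp [substHoles]

theorem count_holes_leftHoles (y : Tuple T c) (k : Fin b) :
    ∑ i, (holes (ρ.leftHoles y i)).count k = 1 := by
  rw [← ρ.linear (Sum.inl k)]
  refine Finset.sum_congr rfl fun i _ => ?_
  rw [leftHoles]
  induction ρ.comp i with
  | nil => rfl
  | cons z l ih =>
    rw [List.flatMap_cons, holes_append, List.count_append, ih]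
    rcases z with a | x | j
    · simp [holes_inl, holes_nil]
    · simp [holes_inr, holes_nil, List.count_cons, List.countP_cons, add_comm]
    · simp [holes_inr, holes_map_inl]

theorem count_holes_rightHoles (x : Tuple T b) (k : Fin c) :
    ∑ i, (holes (ρ.rightHoles x i)).count k = 1 := by
  rw [← ρ.linear (Sum.inr k)]
  refine Finset.sum_congr rfl fun i _ => ?_
  rw [rightHoles]
  induction ρ.comp i with
  | nil => rfl
  | cons z l ih =>
    rw [List.flatMap_cons, holes_append, List.count_append, ih]
    rcases z with a | x | j
    · simp [holes_inl, holes_nil]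
    · simp [holes_inr, holes_map_inl]
    · simp [holes_inr, holes_nil, List.count_cons, List.countP_cons, add_comm]

/-- `E[ρ(□, y)]` is a context, and its interface is the transported one. -/
theorem exists_leftCtx (E : SentCtx T e) (y : Tuple T c) :
    ∃ F : SentCtx T b, (∀ x, F.fill x = E.fill (ρ.apply x y)) ∧
      F.iface h = ρ.itB h (E.iface h) (htype h y) := by
  have hV : ∀ i s, contract ((ρ.comp i).map
      (Sum.elim (fun a => (Sum.inl (h (FreeMonoid.of a)) : M ⊕ Fin b))
        (Sum.elim Sum.inr fun j => Sum.inl (htype h y j)))) s =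
      contract (decorate h (ρ.leftHoles y i)) s := by
    intro i s
    rw [leftHoles]
    induction ρ.comp i with
    | nil => rfl
    | cons z l ih =>
      rw [List.flatMap_cons, decorate_append, contract_append, ← ih]
      rcases z with a | x | j
      · rfl
      · rfl
      · exact (contract_decorate_map_inl h _ _).symm
  obtain ⟨F, h1, h2⟩ := E.exists_plug h (ρ.leftHoles y) (ρ.count_holes_leftHoles y) _ hV
    (linear_traceB h ρ (E.iface h) (htype h y))
  exact ⟨F, fun x => by rw [h1, substHoles_leftHoles], h2⟩

/-- `E[ρ(x, □)]` is a context, and its interface is the transported one. -/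
theorem exists_rightCtx (E : SentCtx T e) (x : Tuple T b) :
    ∃ F : SentCtx T c, (∀ y, F.fill y = E.fill (ρ.apply x y)) ∧
      F.iface h = ρ.itC h (E.iface h) (htype h x) := by
  have hV : ∀ i s, contract ((ρ.comp i).map
      (Sum.elim (fun a => (Sum.inl (h (FreeMonoid.of a)) : M ⊕ Fin c))
        (Sum.elim (fun k => Sum.inl (htype h x k)) Sum.inr))) s =
      contract (decorate h (ρ.rightHoles x i)) s := by
    intro i s
    rw [rightHoles]
    induction ρ.comp i with
    | nil => rfl
    | cons z l ih =>
      rw [List.flatMap_cons, decorate_append, contract_append, ← ih]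
      rcases z with a | x | j
      · rfl
      · exact (contract_decorate_map_inl h _ _).symm
      · rfl
  obtain ⟨F, h1, h2⟩ := E.exists_plug h (ρ.rightHoles x) (ρ.count_holes_rightHoles x) _ hV
    (linear_traceC h ρ (E.iface h) (htype h x))
  exact ⟨F, fun x => by rw [h1, substHoles_rightHoles], h2⟩

theorem htype_apply (x : Tuple T b) (y : Tuple T c) :
    htype h (ρ.apply x y) = ρ.out h (htype h x) (htype h y) := by
  funext i
  rw [htype, apply, out]
  induction ρ.comp i with
  | nil => exact map_one h
  | cons z l ih =>
    rw [List.flatMap_cons, FreeMonoid.ofList_append, map_mul, ih, List.map_cons, List.prod_cons]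
    rcases z with a | k | j <;> rfl

end Template

/-- The empty unary context `□₁`. -/
def emptyCtx (T : Type u) : SentCtx T 1 := ⟨1, fun _ => []⟩

theorem emptyCtx_fill (w : Tuple T 1) : (emptyCtx T).fill w = w 0 := by
  simp [emptyCtx, HoleWord.fill, List.finRange_succ]

theorem emptyCtx_iface : (emptyCtx T).iface h = Iface.st M :=
  Iface.ext rfl (funext fun _ => map_one h)

theorem eq_emptyCtx (E : SentCtx T 1) (hE : E.termLength = 0) : E = emptyCtx T := by
  refine HoleWord.ext (Subsingleton.elim _ _) (funext fun i => ?_)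
  rw [HoleWord.termLength, Finset.sum_eq_zero_iff] at hE
  exact List.length_eq_zero_iff.1 (hE i (Finset.mem_univ i))

end Words

/-! ### Derivation trees -/

namespace Grammar

variable {T : Type u} {N : ℕ → Type w} {G H : Grammar T N}

theorem Tree.rulesUsed_subset {d : ℕ} {A : N d} (t : Tree G A) : t.rulesUsed ⊆ G.rules := by
  induction t with
  | start hR hr t ih => exact Set.insert_subset hr ih
  | term hr => exact Set.singleton_subset_iff.2 hr
  | binary hr t s iht ihs => exact Set.insert_subset hr (Set.union_subset iht ihs)
  | unit hr t ih => exact Set.insert_subset hr ih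

theorem Tree.root_mem_labels {d : ℕ} {A : N d} (t : Tree G A) : ⟨d, A⟩ ∈ t.labels := by
  cases t <;> simp [Tree.labels]

theorem Tree.mem_labels_of_term {d : ℕ} {X : N d} (t : Tree G X) {A : N 1} {a : T}
    (hr : Rule.term A a ∈ t.rulesUsed) : (⟨1, A⟩ : Σ d, N d) ∈ t.labels := by
  induction t with
  | start hR _ t ih => exact Or.inr (ih (hr.resolve_left nofun))
  | term _ => cases hr; exact rfl
  | binary _ t s iht ihs =>
    exact Or.inr ((hr.resolve_left nofun).imp iht ihs)
  | unit _ t ih => exact Or.inr (ih (hr.resolve_left nofun))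

theorem Tree.mem_labels_of_binary {d : ℕ} {X : N d} (t : Tree G X) {e b c : ℕ} {A : N e}
    {ρ : Template T e b c} {B : N b} {C : N c} (hr : Rule.binary A ρ B C ∈ t.rulesUsed) :
    (⟨e, A⟩ : Σ d, N d) ∈ t.labels := by
  induction t with
  | start hR _ t ih => exact Or.inr (ih (hr.resolve_left nofun))
  | term _ => cases hr
  | binary _ t s iht ihs =>
    rcases hr with hr | hr
    · cases hr; exact Or.inl rfl
    · exact Or.inr (hr.imp iht ihs)
  | unit _ t ih => exact Or.inr (ih (hr.resolve_left nofun))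

/-- A derivation tree is a derivation tree of every grammar that has its rules. -/
theorem Tree.exists_transfer (hS : H.S = G.S) {d : ℕ} {A : N d} (t : Tree G A)
    (ht : t.rulesUsed ⊆ H.rules) : ∃ t' : Tree H A, t'.yield = t.yield := by
  induction t with
  | start hR hr t ih =>
    obtain ⟨t', h'⟩ := ih fun r hr => ht (Or.inr hr)
    exact ⟨.start (hR.trans hS.symm) (ht (Or.inl rfl)) t', h'⟩
  | term hr => exact ⟨.term (ht rfl), rfl⟩
  | binary hr t s iht ihs =>
    obtain ⟨t', h1⟩ := iht fun r hr => ht (Or.inr (Or.inl hr))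
    obtain ⟨s', h2⟩ := ihs fun r hr => ht (Or.inr (Or.inr hr))
    exact ⟨.binary (ht (Or.inl rfl)) t' s', by rw [Tree.yield, Tree.yield, h1, h2]⟩
  | unit hr t ih =>
    obtain ⟨t', h'⟩ := ih fun r hr => ht (Or.inr hr)
    exact ⟨.unit (ht (Or.inl rfl)) t', h'⟩

theorem trim_rules_subset (G : Grammar T N) : G.trim.rules ⊆ G.rules :=
  fun _ ⟨t, ht⟩ => t.rulesUsed_subset ht

theorem tupleLang_trim_subset (G : Grammar T N) {d : ℕ} (A : N d) :
    G.trim.tupleLang A ⊆ G.tupleLang A := by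
  rintro _ ⟨t, rfl⟩
  obtain ⟨t', h'⟩ := t.exists_transfer (G := G.trim) (H := G) rfl
    (t.rulesUsed_subset.trans G.trim_rules_subset)
  exact ⟨t', h'⟩

theorem binary_mem_tupleLang {e b c : ℕ} {A : N e} {ρ : Template T e b c} {B : N b} {C : N c}
    (hr : Rule.binary A ρ B C ∈ G.rules) {x : Tuple T b} {y : Tuple T c}
    (hx : x ∈ G.tupleLang B) (hy : y ∈ G.tupleLang C) : ρ.apply x y ∈ G.tupleLang A := by
  obtain ⟨t, rfl⟩ := hx
  obtain ⟨s, rfl⟩ := hy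
  exact ⟨.binary hr t s, rfl⟩

theorem term_mem_tupleLang {A : N 1} {a : T} (hr : Rule.term A a ∈ G.rules) :
    (fun _ => [a]) ∈ G.tupleLang A := ⟨.term hr, rfl⟩

/-- The start symbol occurs on the left-hand side of start rules only. -/
def StartOnly (G : Grammar T N) : Prop :=
  (∀ a, Rule.term G.S a ∉ G.rules) ∧
  (∀ (b c : ℕ) (ρ : Template T 1 b c) (B : N b) (C : N c), Rule.binary G.S ρ B C ∉ G.rules) ∧
  ∀ B, Rule.unit G.S B ∉ G.rules

theorem tupleLang_S_iff (hG : G.StartOnly) (x : Tuple T 1) :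
    x ∈ G.tupleLang G.S ↔ ∃ A, Rule.start A ∈ G.rules ∧ x ∈ G.tupleLang A := by
  constructor
  · rintro ⟨t, rfl⟩
    cases t with
    | start _ hr t => exact ⟨_, hr, t, rfl⟩
    | term hr => exact absurd hr (hG.1 _)
    | binary hr _ _ => exact absurd hr (hG.2.1 _ _ _ _ _)
    | unit hr _ => exact absurd hr (hG.2.2 _)
  · rintro ⟨A, hr, t, rfl⟩
    exact ⟨.start rfl hr t, rfl⟩

theorem mem_language_iff (hG : G.StartOnly) (w : List T) :
    w ∈ G.language ↔ ∃ A, Rule.start A ∈ G.rules ∧ (fun _ => w) ∈ G.tupleLang A :=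
  tupleLang_S_iff hG _

theorem IsWorking.startOnly (hG : G.IsWorking) : G.StartOnly :=
  ⟨fun _ hr => (hG.term_rule _ _ hr).2 rfl,
    fun _ _ _ _ _ hr => (hG.binary_rule _ _ _ _ _ _ _ hr).2.1 rfl,
    fun _ => hG.no_unit _ _ _⟩

theorem IsWorking.mem_nt (hG : G.IsWorking) {d : ℕ} {A : N d} (t : Tree G A) :
    (⟨d, A⟩ : Σ d, N d) ∈ G.nt := by
  cases t with
  | start hR _ _ => exact hR ▸ hG.start_mem
  | term hr => exact (hG.term_rule _ _ hr).1
  | binary hr _ _ => exact (hG.binary_rule _ _ _ _ _ _ _ hr).1.1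
  | unit hr _ => exact absurd hr (hG.no_unit _ _ _)

end Grammar

theorem tuple_one_eq {T : Type u} (x : Tuple T 1) : x = fun _ => x 0 :=
  funext fun i => congrArg x (Subsingleton.elim i 0)

/-! ### Derivations in the typed refinement -/

section Refinement

open Grammar

variable {T : Type u} {M : Type v} [Monoid M] {N : ℕ → Type w} {h : FreeMonoid T →* M}
  {G : Grammar T N}

theorem startOnly_fullRefinement : (fullRefinement h G).StartOnly :=
  ⟨fun _ hr => (by cases hr), fun _ _ _ _ _ hr => (by cases hr), fun _ hr => (by cases hr)⟩

/-- Forgetting the types turns a typed derivation into a derivation of `G`, and the type `p` is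
the type of the derived tuple. -/
theorem Grammar.Tree.exists_untyped {d : ℕ} {X : TypedNT M N d}
    (t : Tree (fullRefinement h G) X) : ∀ {A : N d} {p : Fin d → M} {τ : Iface M d},
    X = .copy A p τ → t.yield ∈ G.tupleLang A ∧ htype h t.yield = p := by
  induction t with
  | start hR _ _ _ => rintro A p τ rfl; cases hR
  | term hr =>
    cases hr with
    | term A a τ hr => rintro _ _ _ ⟨⟩; exact ⟨term_mem_tupleLang hr, rfl⟩
  | binary hr t s iht ihs =>
    cases hr with
    | binary A ρ B C q r τ hr =>
      rintro _ _ _ ⟨⟩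
      obtain ⟨h1, h2⟩ := iht rfl
      obtain ⟨h3, h4⟩ := ihs rfl
      exact ⟨binary_mem_tupleLang hr h1 h3, by
        change htype h (Template.apply _ _ _) = _
        rw [Template.htype_apply, h2, h4]⟩
  | unit hr => cases hr

/-- Every derivation of `G` below the start symbol can be typed, with any given interface at its
root. -/
theorem Grammar.Tree.exists_typed (hG : G.IsWorking) {d : ℕ} {A : N d} (t : Tree G A)
    (hA : (⟨d, A⟩ : Σ d, N d) ≠ ⟨1, G.S⟩) (τ : Iface M d) :
    t.yield ∈ (fullRefinement h G).tupleLang (.copy A (htype h t.yield) τ) := by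
  induction t with
  | start hR => exact absurd (by rw [hR]) hA
  | term hr => exact term_mem_tupleLang (TypedRule.term _ _ τ hr)
  | binary hr t s iht ihs =>
    have h' := (hG.binary_rule _ _ _ _ _ _ _ hr).2.2
    rw [Tree.yield, Template.htype_apply]
    exact binary_mem_tupleLang (G := fullRefinement h G)
      (TypedRule.binary _ _ _ _ _ _ τ hr) (iht h'.1 _) (ihs h'.2 _)
  | unit hr => exact absurd hr (hG.no_unit _ _ _)

theorem language_fullRefinement (hG : G.IsWorking) :
    (fullRefinement h G).language = G.language := by
  ext w
  rw [mem_language_iff startOnly_fullRefinement, mem_language_iff hG.startOnly]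
  constructor
  · rintro ⟨_, hr, t, ht⟩
    cases hr with
    | start A p hr => exact ⟨A, hr, ht ▸ (t.exists_untyped rfl).1⟩
  · rintro ⟨A, hr, t, ht⟩
    have h1 : t.yield = fun _ => w := ht
    have h2 := t.exists_typed (h := h) hG
      (fun he => (hG.start_rule A hr).2 (by cases he; rfl)) (Iface.st M)
    exact ⟨_, TypedRule.start A _ hr, h1 ▸ h2⟩

theorem Grammar.Tree.labels_subset_nt (hG : G.IsWorking) {d : ℕ} {X : TypedNT M N d}
    (t : Tree (fullRefinement h G) X) : t.labels ⊆ (fullRefinement h G).nt := by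
  induction t with
  | start hR _ t ih => exact Set.insert_subset (Or.inl (by rw [hR]; rfl)) ih
  | term hr =>
    cases hr with
    | term A a τ hr =>
      exact Set.singleton_subset_iff.2 (Or.inr ⟨_, _, _, _, (hG.term_rule _ _ hr).1, rfl⟩)
  | binary hr t s iht ihs =>
    cases hr with
    | binary A ρ B C q r τ hr =>
      exact Set.insert_subset (Or.inr ⟨_, _, _, _, (hG.binary_rule _ _ _ _ _ _ _ hr).1.1, rfl⟩)
        (Set.union_subset iht ihs)
  | unit hr => cases hr

variable (h G) in
/-- A typed nonterminal `A_p^τ` is placed if some context `E` of interface `τ` extends every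
derivation tree rooted at `A_p^τ`, with yield `w`, to a successful derivation tree with yield
`E[w]`. The fresh start symbol counts as placed. -/
def IsPlaced : {d : ℕ} → TypedNT M N d → Prop
  | _, .fresh => True
  | d, .copy A p τ => ∃ E : SentCtx T d, E.iface h = τ ∧
      ∀ s : Tree (fullRefinement h G) (.copy A p τ),
        ∃ t : Tree (fullRefinement h G) (fullRefinement h G).S,
          t.yield = (fun _ => E.fill s.yield) ∧ s.labels ⊆ t.labels ∧ s.rulesUsed ⊆ t.rulesUsed

theorem isPlaced_start {A : TypedNT M N 1} (hr : Rule.start A ∈ (fullRefinement h G).rules) :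
    IsPlaced h G A := by
  cases id hr with
  | start A p _ =>
    exact ⟨emptyCtx T, emptyCtx_iface h, fun s => ⟨.start rfl hr s,
      by rw [emptyCtx_fill]; exact tuple_one_eq _, Set.subset_insert _ _, Set.subset_insert _ _⟩⟩

theorem isPlaced_left {e b c : ℕ} {A : TypedNT M N e} {ρ : Template T e b c} {B : TypedNT M N b}
    {C : TypedNT M N c} (hr : Rule.binary A ρ B C ∈ (fullRefinement h G).rules)
    (s : Tree (fullRefinement h G) C) (hA : IsPlaced h G A) : IsPlaced h G B := by
  cases id hr with
  | binary A ρ B C q r τ _ =>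
    obtain ⟨E, rfl, hE⟩ := hA
    obtain ⟨F, h1, h2⟩ := ρ.exists_leftCtx h E s.yield
    refine ⟨F, by rw [h2, (s.exists_untyped rfl).2], fun s' => ?_⟩
    obtain ⟨t, h3, h4, h5⟩ := hE (.binary hr s' s)
    exact ⟨t, by rw [h3, h1]; rfl, fun _ hx => h4 (Or.inr (Or.inl hx)),
      fun _ hx => h5 (Or.inr (Or.inl hx))⟩

theorem isPlaced_right {e b c : ℕ} {A : TypedNT M N e} {ρ : Template T e b c} {B : TypedNT M N b}
    {C : TypedNT M N c} (hr : Rule.binary A ρ B C ∈ (fullRefinement h G).rules)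
    (t : Tree (fullRefinement h G) B) (hA : IsPlaced h G A) : IsPlaced h G C := by
  cases id hr with
  | binary A ρ B C q r τ _ =>
    obtain ⟨E, rfl, hE⟩ := hA
    obtain ⟨F, h1, h2⟩ := ρ.exists_rightCtx h E t.yield
    refine ⟨F, by rw [h2, (t.exists_untyped rfl).2], fun s' => ?_⟩
    obtain ⟨t, h3, h4, h5⟩ := hE (.binary hr t s')
    exact ⟨t, by rw [h3, h1]; rfl, fun _ hx => h4 (Or.inr (Or.inr hx)),
      fun _ hx => h5 (Or.inr (Or.inr hx))⟩

/-- Placement is inherited from the root by all nodes of a derivation tree. -/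
theorem Grammar.Tree.isPlaced_of_mem_labels {d : ℕ} {X : TypedNT M N d}
    (t : Tree (fullRefinement h G) X) (hX : IsPlaced h G X) :
    ∀ Y ∈ t.labels, IsPlaced h G Y.2 := by
  induction t with
  | start hR hr t ih =>
    rintro Y (rfl | hY)
    · exact hX
    · exact ih (isPlaced_start hr) Y hY
  | term hr => rintro Y rfl; exact hX
  | binary hr t s iht ihs =>
    rintro Y (rfl | hY | hY)
    · exact hX
    · exact iht (isPlaced_left hr s hX) Y hY
    · exact ihs (isPlaced_right hr t hX) Y hY
  | unit hr => cases hr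

theorem isPlaced_of_term {A : TypedNT M N 1} {a : T}
    (hr : Rule.term A a ∈ (trimmedRefinement h G).rules) : IsPlaced h G A := by
  obtain ⟨t, ht⟩ := hr
  exact t.isPlaced_of_mem_labels trivial _ (t.mem_labels_of_term ht)

theorem isPlaced_of_binary {e b c : ℕ} {A : TypedNT M N e} {ρ : Template T e b c}
    {B : TypedNT M N b} {C : TypedNT M N c}
    (hr : Rule.binary A ρ B C ∈ (trimmedRefinement h G).rules) : IsPlaced h G A := by
  obtain ⟨t, ht⟩ := hr
  exact t.isPlaced_of_mem_labels trivial _ (t.mem_labels_of_binary ht)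

section Placed

variable {d : ℕ} {A : N d} {p : Fin d → M} {τ : Iface M d}

theorem IsPlaced.rulesUsed_subset (hX : IsPlaced h G (.copy A p τ))
    (s : Tree (fullRefinement h G) (.copy A p τ)) :
    s.rulesUsed ⊆ (trimmedRefinement h G).rules := by
  obtain ⟨E, -, hE⟩ := hX
  obtain ⟨t, -, -, h'⟩ := hE s
  exact fun r hr => ⟨t, h' hr⟩

theorem IsPlaced.mem_nt (hX : IsPlaced h G (.copy A p τ))
    (s : Tree (fullRefinement h G) (.copy A p τ)) :
    (⟨d, .copy A p τ⟩ : Σ d, TypedNT M N d) ∈ (trimmedRefinement h G).nt := by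
  obtain ⟨E, -, hE⟩ := hX
  obtain ⟨t, -, h', -⟩ := hE s
  exact Or.inr ⟨t, h' s.root_mem_labels⟩

theorem IsPlaced.tupleLang_trim (hX : IsPlaced h G (.copy A p τ)) :
    (trimmedRefinement h G).tupleLang (.copy A p τ) =
      (fullRefinement h G).tupleLang (.copy A p τ) := by
  refine (tupleLang_trim_subset _ _).antisymm ?_
  rintro _ ⟨s, rfl⟩
  obtain ⟨t, ht⟩ := s.exists_transfer (G := fullRefinement h G)
    (H := trimmedRefinement h G) rfl (hX.rulesUsed_subset s)
  exact ⟨t, ht⟩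

/-- One context of interface `τ` accepts all tuples derived from a placed `A_p^τ`. -/
theorem IsPlaced.exists_ctx (hG : G.IsWorking) (hX : IsPlaced h G (.copy A p τ)) :
    ∃ E : SentCtx T d, E.iface h = τ ∧
      ∀ w ∈ (fullRefinement h G).tupleLang (.copy A p τ), E.fill w ∈ G.language := by
  obtain ⟨E, h1, hE⟩ := hX
  refine ⟨E, h1, ?_⟩
  rintro _ ⟨s, rfl⟩
  obtain ⟨t, h', -⟩ := hE s
  rw [← language_fullRefinement (h := h) hG]
  exact ⟨t, h'⟩

theorem mem_nt_of_mem_tupleLang (hG : G.IsWorking) {w : Tuple T d}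
    (hw : w ∈ (fullRefinement h G).tupleLang (.copy A p τ)) :
    (⟨d, A⟩ : Σ d, N d) ∈ G.nt := by
  obtain ⟨s, rfl⟩ := hw
  obtain ⟨t, -⟩ := (s.exists_untyped rfl).1
  exact hG.mem_nt t

theorem htype_of_mem_tupleLang {w : Tuple T d}
    (hw : w ∈ (fullRefinement h G).tupleLang (.copy A p τ)) : htype h w = p := by
  obtain ⟨s, rfl⟩ := hw
  exact (s.exists_untyped rfl).2

/-- By substitutability, all tuples derived from a placed `A_p^τ` have the same distribution. -/
theorem IsPlaced.tupleDist_eq {f : ℕ} (hG : G.IsWorking) (hfan : ∀ X ∈ G.nt, X.1 ≤ f)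
    (hL : TupleSubstitutable f h G.language) (hX : IsPlaced h G (.copy A p τ)) {x y : Tuple T d}
    (hx : x ∈ (fullRefinement h G).tupleLang (.copy A p τ))
    (hy : y ∈ (fullRefinement h G).tupleLang (.copy A p τ)) :
    tupleDist G.language x = tupleDist G.language y := by
  have hA := mem_nt_of_mem_tupleLang hG hx
  obtain ⟨E, -, hE⟩ := hX.exists_ctx hG
  exact hL d (hG.fanout_pos _ hA) (hfan _ hA) x y
    ((htype_of_mem_tupleLang hx).trans (htype_of_mem_tupleLang hy).symm) ⟨E, hE x hx, hE y hy⟩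

end Placed

end Refinement

/-! ### The characteristic sample -/

section LeastElements

variable {α : Type u} {r : α → α → Prop}

theorem exists_isLeastFor (hr : IsWellOrder α r) {s : Set α} (hs : s.Nonempty) :
    ∃ a, IsLeastFor r s a := by
  obtain ⟨a, ha, hmin⟩ := hr.wf.has_min s hs
  exact ⟨a, ha, fun b hb hne => by_contra fun hab =>
    hne (hr.trichotomous b a (hmin b hb) hab)⟩

theorem IsLeastFor.unique (hr : IsWellOrder α r) {s : Set α} {a b : α} (ha : IsLeastFor r s a)
    (hb : IsLeastFor r s b) : a = b := by
  by_contra hne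
  exact asymm (ha.2 b hb.1 (Ne.symm hne)) (hb.2 a ha.1 hne)

theorem IsAnchor.unique {T : Type u} {M : Type v} {N : ℕ → Type w} {O : ExposureOrders T}
    {H : Grammar T (TypedNT M N)} {d : ℕ} {X : TypedNT M N d} {x y : Tuple T d}
    (hx : IsAnchor O H X x) (hy : IsAnchor O H X y) : x = y :=
  IsLeastFor.unique (O.tuple_wo d) hx hy

end LeastElements

section Sample

open Grammar

variable {T : Type u} {M : Type v} [Monoid M] {N : ℕ → Type w} {h : FreeMonoid T →* M}
  {G : Grammar T N}

instance [Finite M] (d : ℕ) : Finite (Iface M d) :=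
  Finite.of_injective (fun τ => (τ.perm, τ.val)) fun _ _ he =>
    Iface.ext (congrArg Prod.fst he) (congrArg Prod.snd he)

theorem finite_nt_fullRefinement [Finite M] (hG : G.IsWorking) :
    (fullRefinement h G).nt.Finite := by
  refine Set.Finite.insert _ ((hG.finite_nt.biUnion fun X _ => Set.finite_range
    fun i : (Fin X.1 → M) × Iface M X.1 =>
      (⟨X.1, .copy X.2 i.1 i.2⟩ : Σ d, TypedNT M N d)).subset ?_)
  rintro _ ⟨d, A, p, τ, hA, rfl⟩
  exact Set.mem_biUnion hA ⟨(p, τ), rfl⟩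

variable (h) in
/-- The typed copies of a rule. -/
def typedCopies : Rule T N → Set (Rule T (TypedNT M N))
  | .start A => Set.range fun p => .start (.copy A p (Iface.st M))
  | .term A a => Set.range fun τ => .term (.copy A (fun _ => h (FreeMonoid.of a)) τ) a
  | .binary (e := e) (b := b) (c := c) A ρ B C =>
      Set.range fun i : (Fin b → M) × (Fin c → M) × Iface M e =>
        .binary (.copy A (ρ.out h i.1 i.2.1) i.2.2) ρ (.copy B i.1 (ρ.itB h i.2.2 i.2.1))
          (.copy C i.2.1 (ρ.itC h i.2.2 i.1))
  | .unit _ _ => ∅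

theorem finite_typedCopies [Finite M] (r : Rule T N) : (typedCopies h r).Finite := by
  cases r
  · exact Set.finite_range _
  · exact Set.finite_range _
  · exact Set.finite_range _
  · exact Set.finite_empty

theorem finite_rules_fullRefinement [Finite M] (hG : G.IsWorking) :
    (fullRefinement h G).rules.Finite := by
  refine (hG.finite_rules.biUnion fun r _ => finite_typedCopies (h := h) r).subset ?_
  intro r hr
  cases hr with
  | start A p hr => exact Set.mem_biUnion hr ⟨p, rfl⟩
  | term A a τ hr => exact Set.mem_biUnion hr ⟨τ, rfl⟩
  | binary A ρ B C q r τ hr => exact Set.mem_biUnion hr ⟨(q, r, τ), rfl⟩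

variable {O : ExposureOrders T} {L : Set (List T)} {H : Grammar T (TypedNT M N)} {d : ℕ}
  {A : N d} {p : Fin d → M} {τ : Iface M d}

theorem IsExposing.unique {x : Tuple T d} {E F : SentCtx T d} (hE : IsExposing O h L τ x E)
    (hF : IsExposing O h L τ x F) : E = F :=
  IsLeastFor.unique (O.ctx_wo d) hE hF

variable (O h L H) in
/-- The observation of a typed nonterminal; there is at most one. -/
def symbolObs (X : Σ d, TypedNT M N d) : Set (List T) :=
  {w | ∃ (A : N X.1) (p : Fin X.1 → M) (τ : Iface M X.1) (ω : Tuple T X.1) (χ : SentCtx T X.1),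
    X.2 = .copy A p τ ∧ IsAnchor O H X.2 ω ∧ IsExposing O h L τ ω χ ∧ w = χ.fill ω}

theorem subsingleton_symbolObs (X : Σ d, TypedNT M N d) :
    (symbolObs h O L H X).Subsingleton := by
  obtain ⟨d, X⟩ := X
  rintro _ ⟨A, p, τ, ω, χ, h1, h2, h3, rfl⟩ _ ⟨A', p', τ', ω', χ', h1', h2', h3', rfl⟩
  cases h1.symm.trans h1'
  cases h2.unique h2'
  rw [h3.unique h3']

variable (O h L H) in
/-- The observation of a typed rule; there is at most one. -/
def ruleObs (r : Rule T (TypedNT M N)) : Set (List T) :=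
  {w | (∃ (A : N 1) (p : Fin 1 → M) (τ : Iface M 1) (a : T) (ω : Tuple T 1) (χ : SentCtx T 1),
      r = .term (.copy A p τ) a ∧ IsAnchor O H (.copy A p τ) ω ∧ IsExposing O h L τ ω χ ∧
        w = χ.fill fun _ => [a]) ∨
    ∃ (e b c : ℕ) (A : N e) (p : Fin e → M) (τ : Iface M e) (ρ : Template T e b c)
      (Y : TypedNT M N b) (Z : TypedNT M N c) (ω : Tuple T e) (ωY : Tuple T b) (ωZ : Tuple T c)
      (χ : SentCtx T e), r = .binary (.copy A p τ) ρ Y Z ∧ IsAnchor O H (.copy A p τ) ω ∧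
        IsExposing O h L τ ω χ ∧ IsAnchor O H Y ωY ∧ IsAnchor O H Z ωZ ∧
        w = χ.fill (ρ.apply ωY ωZ)}

theorem subsingleton_ruleObs (r : Rule T (TypedNT M N)) : (ruleObs h O L H r).Subsingleton := by
  rintro _ (⟨A, p, τ, a, ω, χ, h1, h2, h3, rfl⟩ |
      ⟨e, b, c, A, p, τ, ρ, Y, Z, ω, ωY, ωZ, χ, h1, h2, h3, h4, h5, rfl⟩) _
    (⟨A', p', τ', a', ω', χ', h1', h2', h3', rfl⟩ |
      ⟨e', b', c', A', p', τ', ρ', Y', Z', ω', ωY', ωZ', χ', h1', h2', h3', h4', h5', rfl⟩)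
  all_goals subst h1; cases h1'
  · cases h2.unique h2'
    rw [h3.unique h3']
  · cases h2.unique h2'
    cases h4.unique h4'
    cases h5.unique h5'
    rw [h3.unique h3']

theorem finite_charSample (hnt : H.nt.Finite) (hrules : H.rules.Finite) :
    (charSample O h L H).Finite := by
  refine ((hnt.biUnion fun X _ => (subsingleton_symbolObs (O := O) (h := h) (L := L)
    (H := H) X).finite).union (hrules.biUnion fun r _ => (subsingleton_ruleObs (O := O) (h := h)
    (L := L) (H := H) r).finite)).subset ?_
  intro w hw
  cases hw with
  | symbol hX hω hχ => exact Or.inl (Set.mem_biUnion hX ⟨_, _, _, _, _, rfl, hω, hχ, rfl⟩)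
  | term hR hω hχ =>
    exact Or.inr (Set.mem_biUnion hR (Or.inl ⟨_, _, _, _, _, _, rfl, hω, hχ, rfl⟩))
  | binary hR hω hχ hY hZ =>
    exact Or.inr (Set.mem_biUnion hR
      (Or.inr ⟨_, _, _, _, _, _, _, _, _, _, _, _, _, rfl, hω, hχ, hY, hZ, rfl⟩))

theorem finite_nt_trimmedRefinement [Finite M] (hG : G.IsWorking) :
    (trimmedRefinement h G).nt.Finite := by
  refine ((finite_nt_fullRefinement (h := h) hG).subset ?_)
  rintro X (rfl | ⟨t, ht⟩)
  · exact Or.inl rfl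
  · exact t.labels_subset_nt hG ht

theorem IsPlaced.exists_anchor (O : ExposureOrders T) (hX : IsPlaced h G (.copy A p τ))
    {w : Tuple T d} (hw : w ∈ (fullRefinement h G).tupleLang (.copy A p τ)) :
    ∃ ω, IsAnchor O (trimmedRefinement h G) (.copy A p τ) ω :=
  exists_isLeastFor (O.tuple_wo d) ⟨w, hX.tupleLang_trim.symm ▸ hw⟩

theorem IsPlaced.exists_exposing (O : ExposureOrders T) (hG : G.IsWorking)
    (hX : IsPlaced h G (.copy A p τ)) {w : Tuple T d}
    (hw : w ∈ (fullRefinement h G).tupleLang (.copy A p τ)) :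
    ∃ χ, IsExposing O h G.language τ w χ := by
  obtain ⟨E, h1, hE⟩ := hX.exists_ctx hG
  exact exists_isLeastFor (O.ctx_wo d) ⟨E, h1, hE w hw⟩

theorem IsAnchor.mem_full {ω : Tuple T d}
    (hω : IsAnchor O (trimmedRefinement h G) (.copy A p τ) ω) :
    ω ∈ (fullRefinement h G).tupleLang (.copy A p τ) :=
  tupleLang_trim_subset _ _ hω.1

/-- The exposing context of a placed nonterminal accepts every tuple derived from it. -/
theorem IsPlaced.fill_mem {f : ℕ} (hG : G.IsWorking) (hfan : ∀ X ∈ G.nt, X.1 ≤ f)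
    (hL : TupleSubstitutable f h G.language) (hX : IsPlaced h G (.copy A p τ)) {ω x : Tuple T d}
    {χ : SentCtx T d} (hω : IsAnchor O (trimmedRefinement h G) (.copy A p τ) ω)
    (hχ : IsExposing O h G.language τ ω χ)
    (hx : x ∈ (fullRefinement h G).tupleLang (.copy A p τ)) : χ.fill x ∈ G.language := by
  have h1 : χ ∈ tupleDist G.language ω := hχ.1.2
  rwa [hX.tupleDist_eq hG hfan hL hω.mem_full hx] at h1

theorem charSample_subset {f : ℕ} (hG : G.IsWorking) (hfan : ∀ X ∈ G.nt, X.1 ≤ f)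
    (hL : TupleSubstitutable f h G.language) :
    charSample O h G.language (trimmedRefinement h G) ⊆ G.language := by
  intro w hw
  cases hw with
  | symbol hX hω hχ => exact hχ.1.2
  | term hR hω hχ =>
    exact (isPlaced_of_term hR).fill_mem hG hfan hL hω hχ
      (term_mem_tupleLang (trim_rules_subset _ hR))
  | binary hR hω hχ hY hZ =>
    exact (isPlaced_of_binary hR).fill_mem hG hfan hL hω hχ
      (tupleLang_trim_subset _ _ (binary_mem_tupleLang hR hY.1 hZ.1))

/-! ### The learner -/

variable {f : ℕ} {K : Finset (List T)}

theorem startOnly_learnerGrammar : (learnerGrammar f h K).StartOnly :=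
  ⟨fun _ hr => (by cases hr), fun _ _ _ _ _ hr => (by cases hr), fun _ hr => (by cases hr)⟩

/-- Derivations of the learner stay within one distribution: every tuple derived from `[x : τ]` is
distributed as `x`. -/
theorem Grammar.Tree.tupleDist_yield (hL : TupleSubstitutable f h L)
    (hK : (K : Set (List T)) ⊆ L) {d : ℕ} {X : LearnerNT T M d}
    (t : Tree (learnerGrammar f h K) X) : ∀ {x : Tuple T d} {τ : Iface M d},
    X = .tup x τ → tupleDist L t.yield = tupleDist L x := by
  induction t with
  | start hR => rintro x τ rfl; cases hR
  | term hr =>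
    cases hr with
    | term a τ _ => rintro _ _ ⟨⟩; rfl
  | @binary _ _ _ _ ρ _ _ hr t s iht ihs =>
    cases hr with
    | binary E z _ x τB y τC hwit =>
      rintro _ _ ⟨⟩
      have h1 := iht rfl
      have h2 := ihs rfl
      ext F
      -- Exchange the tuple derived from the left child for `x` first, with the right one in place,
      -- and then the tuple derived from the right child for `y`.
      obtain ⟨FB, hFB, -⟩ := ρ.exists_leftCtx h F s.yield
      obtain ⟨FC, hFC, -⟩ := ρ.exists_rightCtx h F x
      have h3 : FB ∈ tupleDist L t.yield ↔ FB ∈ tupleDist L x := by rw [h1]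
      have h4 : FC ∈ tupleDist L s.yield ↔ FC ∈ tupleDist L y := by rw [h2]
      simp only [tupleDist, Set.mem_ofPred_eq, hFB, hFC, hwit.segmentation] at h3 h4 ⊢
      exact h3.trans h4
  | unit hr t ih =>
    cases hr with
    | subst x y τ hx hy hxy E _ hEx hEy =>
      rintro _ _ ⟨⟩
      exact (ih rfl).trans (hL _ hx.1 hx.2.1 x y hxy ⟨E, hK hEx, hK hEy⟩).symm

theorem language_learnerGrammar_subset (hL : TupleSubstitutable f h L)
    (hK : (K : Set (List T)) ⊆ L) : (learnerGrammar f h K).language ⊆ L := by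
  intro w hw
  rw [mem_language_iff startOnly_learnerGrammar] at hw
  obtain ⟨_, hr, t, ht⟩ := hw
  cases hr with
  | start v hv _ =>
    have h1 : emptyCtx T ∈ tupleDist L fun _ => v := by
      rw [tupleDist, Set.mem_ofPred_eq, emptyCtx_fill]
      exact hK hv
    rw [← t.tupleDist_yield hL hK rfl, show t.yield = fun _ => w from ht, tupleDist,
      Set.mem_ofPred_eq, emptyCtx_fill] at h1
    exact h1

theorem unit_mem_tupleLang {G : Grammar T N} {A B : N d} (hr : Rule.unit A B ∈ G.rules)
    {x : Tuple T d} (hx : x ∈ G.tupleLang B) : x ∈ G.tupleLang A := by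
  obtain ⟨t, rfl⟩ := hx
  exact ⟨.unit hr t, rfl⟩

/-- The learner simulates the typed refinement, with `[ω : τ]` in the role of a nonterminal
`A_p^τ` with anchor `ω`. -/
theorem Grammar.Tree.yield_mem_learner (hG : G.IsWorking) (hfan : ∀ X ∈ G.nt, X.1 ≤ f)
    (hK : charSample O h G.language (trimmedRefinement h G) ⊆ (K : Set (List T)))
    {d : ℕ} {X : TypedNT M N d} (t : Tree (fullRefinement h G) X) :
    ∀ {A : N d} {p : Fin d → M} {τ : Iface M d}, X = .copy A p τ → IsPlaced h G X →
      ∀ ω, IsAnchor O (trimmedRefinement h G) X ω →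
        Observed f h K ω τ ∧ t.yield ∈ (learnerGrammar f h K).tupleLang (.tup ω τ) := by
  -- The symbol observation makes `[ω : τ]` observed, and a tuple `z` of the same type that the
  -- exposing context accepts in `K` is reached from it by a unit rule.
  have key : ∀ {d : ℕ} {A : N d} {p : Fin d → M} {τ : Iface M d} {ω z : Tuple T d}
      {χ : SentCtx T d}, IsPlaced h G (.copy A p τ) →
      IsAnchor O (trimmedRefinement h G) (.copy A p τ) ω → IsExposing O h G.language τ ω χ →
      z ∈ (fullRefinement h G).tupleLang (.copy A p τ) → χ.fill z ∈ K →
      Observed f h K ω τ ∧ Observed f h K z τ ∧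
        Rule.unit (.tup ω τ) (.tup z τ) ∈ (learnerGrammar f h K).rules := by
    intro d A p τ ω z χ hX hω hχ hz hzK
    have hA := mem_nt_of_mem_tupleLang hG hz
    obtain ⟨s, hs⟩ := hz
    have hωK : χ.fill ω ∈ K := hK (.symbol (hX.mem_nt s) hω hχ)
    have h1 : Observed f h K ω τ := ⟨hG.fanout_pos _ hA, hfan _ hA, χ, hωK, hχ.1.1⟩
    have h2 : Observed f h K z τ := ⟨hG.fanout_pos _ hA, hfan _ hA, χ, hzK, hχ.1.1⟩
    exact ⟨h1, h2, .subst ω z τ h1 h2 ((htype_of_mem_tupleLang hω.mem_full).trans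
      (htype_of_mem_tupleLang ⟨s, hs⟩).symm) χ hχ.1.1 hωK hzK⟩
  induction t with
  | start hR => rintro A p τ rfl; cases hR
  | @term _ a hr =>
    cases id hr with
    | term A _ τ _ =>
      rintro _ _ _ ⟨⟩ hX ω hω
      obtain ⟨χ, hχ⟩ := hX.exists_exposing O hG hω.mem_full
      have hmem := term_mem_tupleLang hr
      obtain ⟨h1, h2, h3⟩ := key hX hω hχ hmem
        (hK (.term (hX.rulesUsed_subset (.term hr) rfl) hω hχ))
      exact ⟨h1, unit_mem_tupleLang h3 (term_mem_tupleLang (.term a τ h2))⟩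
  | @binary _ _ _ _ ρ _ _ hr t s iht ihs =>
    cases id hr with
    | binary A _ B C q r τ _ =>
      rintro _ _ _ ⟨⟩ hX ω hω
      have hB := isPlaced_left hr s hX
      have hC := isPlaced_right hr t hX
      obtain ⟨χ, hχ⟩ := hX.exists_exposing O hG hω.mem_full
      obtain ⟨ωB, hωB⟩ := hB.exists_anchor O ⟨t, rfl⟩
      obtain ⟨ωC, hωC⟩ := hC.exists_anchor O ⟨s, rfl⟩
      obtain ⟨oB, tB⟩ := iht rfl hB ωB hωB
      obtain ⟨oC, tC⟩ := ihs rfl hC ωC hωC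
      have hmem := binary_mem_tupleLang hr hωB.mem_full hωC.mem_full
      have hzK : χ.fill (ρ.apply ωB ωC) ∈ K :=
        hK (.binary (hX.rulesUsed_subset (.binary hr t s) (Or.inl rfl)) hω hχ hωB hωC)
      obtain ⟨h1, h2, h3⟩ := key hX hω hχ hmem hzK
      have hχτ : χ.iface h = τ := hχ.1.1
      have hrule := LearnerRule.binary χ _ ρ ωB _ ωC _ ⟨h2.1, h2.2.1, hzK, oB, oC, rfl,
        by rw [hχτ, htype_of_mem_tupleLang hωC.mem_full],
        by rw [hχτ, htype_of_mem_tupleLang hωB.mem_full]⟩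
      rw [hχτ] at hrule
      exact ⟨h1, unit_mem_tupleLang h3 (binary_mem_tupleLang
        (G := learnerGrammar f h K) hrule tB tC)⟩
  | unit hr => cases hr

theorem subset_language_learnerGrammar (hG : G.IsWorking) (hfan : ∀ X ∈ G.nt, X.1 ≤ f)
    (hK : charSample O h G.language (trimmedRefinement h G) ⊆ (K : Set (List T))) :
    G.language ⊆ (learnerGrammar f h K).language := by
  intro w hw
  rw [← language_fullRefinement (h := h) hG, mem_language_iff startOnly_fullRefinement] at hw
  obtain ⟨_, hr, t, ht⟩ := hw
  rw [mem_language_iff startOnly_learnerGrammar]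
  have hX := isPlaced_start hr
  cases id hr with
  | start A p _ =>
    obtain ⟨ω, hω⟩ := hX.exists_anchor O ⟨t, rfl⟩
    obtain ⟨χ, hχ⟩ := hX.exists_exposing O hG hω.mem_full
    obtain ⟨h1, h2⟩ := t.yield_mem_learner hG hfan hK rfl hX ω hω
    -- The empty context is the unique context without letters, so it is the exposing one.
    have hω' : (emptyCtx T).fill ω ∈ G.language := by
      obtain ⟨v, hv⟩ := hω.mem_full
      rw [← language_fullRefinement (h := h) hG, emptyCtx_fill]
      exact ⟨.start rfl hr v, hv.trans (tuple_one_eq _)⟩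
    have hχ' : χ = emptyCtx T := by
      by_contra hne
      have hpos : (emptyCtx T).termLength < χ.termLength := by
        have h0 : (emptyCtx T).termLength = 0 := by simp [HoleWord.termLength, emptyCtx]
        rw [h0]
        exact Nat.pos_of_ne_zero fun h0 => hne (eq_emptyCtx χ h0)
      have := O.ctx_wo 1
      exact asymm (O.ctx_length 1 _ _ hpos)
        (hχ.2 _ ⟨emptyCtx_iface h, hω'⟩ (Ne.symm hne))
    have hωK : ω 0 ∈ K := by
      rw [← emptyCtx_fill ω, ← hχ']
      exact hK (.symbol (hX.mem_nt t) hω hχ)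
    rw [tuple_one_eq ω] at h1 h2
    exact ⟨_, .start _ hωK h1, ht ▸ h2⟩

end Sample


end TupleMCFG

theorem theorem8p10 {T : Type*} {M : Type*} [Finite T] [Monoid M] [Finite M] {N : ℕ → Type*}
    (f : ℕ) (hf : 1 ≤ f) (h : FreeMonoid T →* M) (O : TupleMCFG.ExposureOrders T)
    (G : TupleMCFG.Grammar T N) (hG : G.IsWorking) (hred : G.IsReduced)
    (hfan : ∀ X ∈ G.nt, X.1 ≤ f)
    (hL : TupleMCFG.TupleSubstitutable f h G.language) :
    (TupleMCFG.charSample O h G.language (TupleMCFG.trimmedRefinement h G)).Finite ∧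
    TupleMCFG.charSample O h G.language (TupleMCFG.trimmedRefinement h G) ⊆ G.language ∧
    ∀ K : Finset (List T),
      TupleMCFG.charSample O h G.language (TupleMCFG.trimmedRefinement h G) ⊆ (K : Set (List T)) →
      (K : Set (List T)) ⊆ G.language →
      (TupleMCFG.learnerGrammar f h K).language = G.language :=
  ⟨TupleMCFG.finite_charSample (TupleMCFG.finite_nt_trimmedRefinement hG)
      ((TupleMCFG.finite_rules_fullRefinement hG).subset
        (TupleMCFG.Grammar.trim_rules_subset _)),
    TupleMCFG.charSample_subset hG hfan hL,
    fun _ hK hKL => (TupleMCFG.language_learnerGrammar_subset hL hKL).antisymm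
      (TupleMCFG.subset_language_learnerGrammar hG hfan hK)⟩
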